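/- Let $k$ be a field, $r\ge 3$, $R=k[x_0,\dots,x_r]$ with the standard grading, $\mathbb P^r=\operatorname{Proj}R$, and let $n\ge 3$. Let $h_1,h_2,h_3\in R$, $A\in R^{n\times 3}$, $C\in R^{n\times(n-3)}$, and put $$K=\begin{pmatrix}0&h_3&-h_2\\-h_3&0&h_1\\h_2&-h_1&0\end{pmatrix},\qquad B=\begin{pmatrix}&A&&&C&\\h_1&h_2&h_3&0&\cdots&0\end{pmatrix}\in R^{(n+1)\times n}.$$ For $1\le i\le n+1$ let $B_i$ be $(-1)^i$ times the determinant of the matrix obtained from $B$ by deleting its $i$-th row. Let $\alpha,\kappa,\delta$ be the maps represented by $A,K,C$; let $\tau(1)=(h_1,h_2,h_3)$, and let $\gamma:R^n\to R$ be the map given by the row $(B_1,\dots,B_n)$. Let $X\subset\mathbb P^r$ be a closed subscheme whose defining ideal $I_X$ has the graded minimal free resolution $$0\to R\xrightarrow{\ \rho=(\tau,0)\ }R^3\oplus R^{n-3}\xrightarrow{\ \varphi=\alpha\kappa\oplus\delta\ }R^n\xrightarrow{\ \gamma\ }I_X\to 0 ,$$ that is, this sequence is exact, the maps $\rho,\alpha,\kappa,\delta,\gamma$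 are graded of degree $0$ for suitable twists of the free modules (including the module $R^3$ through which $\alpha\kappa$ factors), and all the entries of the matrices of $\rho$ and $\varphi$ lie in $(x_0,\dots,x_r)$. Let $Z$ be the closed subscheme of $\mathbb P^r$ defined by $I(\rho)=I(\tau)=(h_1,h_2,h_3)$, let $S=V(\det(\alpha\oplus\delta))$, where $\det(\alpha\oplus\delta)=\det(A\,|\,C)$, and let $Y$ be the closed subscheme defined by $I(\alpha\oplus\delta,\rho^*)=I(B)=(B_1,\dots,B_{n+1})$. Suppose that $S\cap Z$ has codimension $4$, or more generally at least $4$, where the codimension of $S\cap Z$ is understood as the height in $R$ of the ideal $(h_1,h_2,h_3,\det(A\,|\,C))$ (the unit ideal having infinite height; so $S\cap Z$ is empty if $r=3$). Then $X=Y\cup Z$ as closed subschemes of $\mathbb P^r$, i.e. the ideal sheaf of $X$ is the intersection of the ideal sheaves of $Y$ and $Z$; moreover $I_X=I(B)\cap(h_1,h_2,h_3)$ in $R$. -/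

import Mathlib

open AlgebraicGeometry CategoryTheory

namespace GenGor

noncomputable section

universe u

/-! ### Projective space and closed subschemes defined by homogeneous ideals -/

/-- The homogeneous coordinate ring `k[x₀, …, x_r]` of `ℙ^r`. -/
abbrev CoordRing (k : Type u) [Field k] (r : ℕ) : Type u := MvPolynomial (Fin (r + 1)) k

/-- The standard grading of the coordinate ring by total degree. -/
abbrev stdGrading (k : Type u) [Field k] (r : ℕ) : ℕ → Submodule k (CoordRing k r) :=
  MvPolynomial.homogeneousSubmodule (Fin (r + 1)) k

instance instGradedAlgebraStd (k : Type u) [Field k] (r : ℕ) : GradedAlgebra (stdGrading k r) :=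
  MvPolynomial.gradedAlgebra

/-- Projective space `ℙ^r` over `k`. -/
abbrev ProjSpace (k : Type u) [Field k] (r : ℕ) : Scheme.{u} := Proj (stdGrading k r)

/-- Closed subschemes of `ℙ^r`, given by their (quasi-coherent) ideal sheaves. The order is the
order of ideal sheaves, so the scheme-theoretic union of two closed subschemes is their `⊓`. -/
abbrev ClosedSubscheme (k : Type u) [Field k] (r : ℕ) : Type u :=
  (ProjSpace k r).IdealSheafData

variable {k : Type u} [Field k] {r : ℕ}

/-- The scheme-theoretic union `Y ∪ Z`: its ideal sheaf is the intersection of the ideal sheaves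
of `Y` and of `Z`. -/
def schemeUnion (Y Z : ClosedSubscheme k r) : ClosedSubscheme k r := Y ⊓ Z

/-- The stalk at `x` of the ideal sheaf associated with a homogeneous ideal `I`: the fractions of
degree `0` in the homogeneous localization at `x` that lie in the localization of `I` at `x`. -/
def stalkIdeal (I : Ideal (CoordRing k r)) (x : ProjectiveSpectrum (stdGrading k r)) :
    Ideal (HomogeneousLocalization.AtPrime (stdGrading k r) x.asHomogeneousIdeal.toIdeal) :=
  (I.map (algebraMap (CoordRing k r)
    (Localization.AtPrime x.asHomogeneousIdeal.toIdeal))).comap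
      (algebraMap (HomogeneousLocalization.AtPrime (stdGrading k r) x.asHomogeneousIdeal.toIdeal)
        (Localization.AtPrime x.asHomogeneousIdeal.toIdeal))

/-- The value of a section of the structure sheaf over `U` at a point `x` of `U`. -/
def evalAt (U : (ProjSpace k r).Opens) (x : ProjectiveSpectrum (stdGrading k r)) (hx : x ∈ U) :
    Γ(ProjSpace k r, U) →+*
      HomogeneousLocalization.AtPrime (stdGrading k r) x.asHomogeneousIdeal.toIdeal :=
  (openToLocalization (stdGrading k r) U x hx).hom

/-- The sections over `U` of the ideal sheaf associated with `I`: the sections of the structure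
sheaf over `U` whose value at every point `x` of `U` lies in the stalk of the ideal sheaf. -/
def sectionIdeal (I : Ideal (CoordRing k r)) (U : (ProjSpace k r).Opens) :
    Ideal Γ(ProjSpace k r, U) :=
  ⨅ (x : ProjectiveSpectrum (stdGrading k r)) (hx : x ∈ U),
    (stalkIdeal I x).comap (evalAt U x hx)

/-- The closed subscheme `V(I)` of `ℙ^r` defined by a homogeneous ideal `I`. -/
def closedSubscheme (I : Ideal (CoordRing k r)) : ClosedSubscheme k r :=
  Scheme.IdealSheafData.ofIdeals fun U => sectionIdeal I U.1

/-! ### Matrices -/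

section Matrices

variable {R : Type u} [CommRing R] {m : ℕ}

/-- The matrix `K` of the central map `κ` of the Koszul complex on `(h₁, h₂, h₃)`. -/
def koszulMatrix (h : Fin 3 → R) : Matrix (Fin 3) (Fin 3) R :=
  !![0, h 2, -h 1; -h 2, 0, h 0; h 1, -h 0, 0]

/-- The square matrix `(A | C)` of size `n = 3 + m` of the map `α ⊕ δ`. -/
def blockMatrix (A : Matrix (Fin (3 + m)) (Fin 3) R) (C : Matrix (Fin (3 + m)) (Fin m) R) :
    Matrix (Fin (3 + m)) (Fin (3 + m)) R :=
  Matrix.of fun i => Fin.append (A i) (C i)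

/-- The vector `(h₁, h₂, h₃, 0, …, 0)` of length `n`. -/
def rhoVec (m : ℕ) (h : Fin 3 → R) : Fin (3 + m) → R :=
  Fin.append h (fun _ : Fin m => 0)

/-- The matrix `M = (AK | C)` of the map `φ = ακ ⊕ δ`. -/
def phiMatrix (h : Fin 3 → R) (A : Matrix (Fin (3 + m)) (Fin 3) R)
    (C : Matrix (Fin (3 + m)) (Fin m) R) : Matrix (Fin (3 + m)) (Fin (3 + m)) R :=
  blockMatrix (A * koszulMatrix h) C

/-- The `(n+1) × n` matrix `B` whose first `n` rows are those of `(A | C)` and whose last row is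
`(h₁, h₂, h₃, 0, …, 0)`; it represents the map with components `α ⊕ δ` and `ρ^*`. -/
def bMatrix (h : Fin 3 → R) (A : Matrix (Fin (3 + m)) (Fin 3) R)
    (C : Matrix (Fin (3 + m)) (Fin m) R) : Matrix (Fin (3 + m + 1)) (Fin (3 + m)) R :=
  Matrix.of (Fin.snoc (α := fun _ => Fin (3 + m) → R) (blockMatrix A C) (rhoVec m h))

/-- The signed maximal minor of an `(n+1) × n` matrix obtained by deleting row `i`. Rows are
numbered from `0` here, so the sign `(-1)^(i+1)` is `(-1)` to the usual number of the row. -/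
def signedMinor {n : ℕ} (B : Matrix (Fin (n + 1)) (Fin n) R) (i : Fin (n + 1)) : R :=
  (-1) ^ ((i : ℕ) + 1) * (B.submatrix i.succAbove id).det

/-- The row `(B₁, …, B_n)` of the signed maximal minors of `B` that involve the last row. -/
def gammaVec (h : Fin 3 → R) (A : Matrix (Fin (3 + m)) (Fin 3) R)
    (C : Matrix (Fin (3 + m)) (Fin m) R) : Fin (3 + m) → R :=
  fun i => signedMinor (bMatrix h A C) i.castSucc

/-- `ρ : R → R^n`, `1 ↦ (h₁, h₂, h₃, 0, …, 0)`. -/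
def rhoMap (m : ℕ) (h : Fin 3 → R) : R →ₗ[R] (Fin (3 + m) → R) :=
  LinearMap.toSpanSingleton R (Fin (3 + m) → R) (rhoVec m h)

/-- `φ = ακ ⊕ δ : R^n → R^n`. -/
def phiMap (h : Fin 3 → R) (A : Matrix (Fin (3 + m)) (Fin 3) R)
    (C : Matrix (Fin (3 + m)) (Fin m) R) : (Fin (3 + m) → R) →ₗ[R] (Fin (3 + m) → R) :=
  (phiMatrix h A C).mulVecLin

/-- `γ : R^n → R`, `v ↦ ∑ vᵢ Bᵢ`. -/
def gammaMap (h : Fin 3 → R) (A : Matrix (Fin (3 + m)) (Fin 3) R)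
    (C : Matrix (Fin (3 + m)) (Fin m) R) : (Fin (3 + m) → R) →ₗ[R] R :=
  Fintype.linearCombination R (gammaVec h A C)

/-- `I(ρ) = I(τ)`: the ideal generated by `h₁, h₂, h₃`. -/
def idealRho (h : Fin 3 → R) : Ideal R := Ideal.span (Set.range h)

/-- The ideal generated by `det (α ⊕ δ)`. -/
def idealDet (A : Matrix (Fin (3 + m)) (Fin 3) R) (C : Matrix (Fin (3 + m)) (Fin m) R) : Ideal R :=
  Ideal.span {(blockMatrix A C).det}

/-- `I(α ⊕ δ, ρ^*)`: the ideal generated by all the maximal minors of `B`. -/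
def idealB (h : Fin 3 → R) (A : Matrix (Fin (3 + m)) (Fin 3) R)
    (C : Matrix (Fin (3 + m)) (Fin m) R) : Ideal R :=
  Ideal.span (Set.range (signedMinor (bMatrix h A C)))

end Matrices

/-! ### Graded minimal free resolutions -/

/-- `p` is homogeneous of degree `d ∈ ℤ` (the zero polynomial is homogeneous of every degree, and
it is the only polynomial that is homogeneous of a negative degree). -/
def IsHomogeneousZ (p : CoordRing k r) (d : ℤ) : Prop :=
  ∀ e ∈ p.support, (e.degree : ℤ) = d

/-- The ideal `I` of `k[x₀, …, x_r]` has the graded minimal free resolution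
`0 → R --ρ--> R³ ⊕ R^m --ακ ⊕ δ--> R^n --γ--> I → 0`, `n = 3 + m`, where
`ρ(1) = (h₁, h₂, h₃, 0, …, 0)`, the maps `α`, `κ`, `δ` are given by the matrices `A`, `K`, `C`,
and `γ` is given by the row `(B₁, …, B_n)`. -/
structure IsGradedMinimalResolution {m : ℕ} (I : Ideal (CoordRing k r))
    (h : Fin 3 → CoordRing k r)
    (A : Matrix (Fin (3 + m)) (Fin 3) (CoordRing k r))
    (C : Matrix (Fin (3 + m)) (Fin m) (CoordRing k r)) : Prop where
  /-- `I` is the image of `γ`. -/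
  range_gamma : LinearMap.range (gammaMap h A C) = I
  exact_phi_gamma : Function.Exact (phiMap h A C) (gammaMap h A C)
  exact_rho_phi : Function.Exact (rhoMap m h) (phiMap h A C)
  injective_rho : Function.Injective (rhoMap m h)
  /-- All maps are graded of degree zero, for suitable twists `R(-s)` of the last module,
  `⊕ R(-b j)` of `R³ ⊕ R^m`, `⊕ R(-c j)` of the `R³` in the middle of
  `R³ --κ--> R³ --α--> R^n`, and `⊕ R(-a i)` of `R^n`. -/
  graded : ∃ (a : Fin (3 + m) → ℤ) (b : Fin (3 + m) → ℤ) (c : Fin 3 → ℤ) (s : ℤ),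
    (∀ j, IsHomogeneousZ (h j) (s - b (Fin.castAdd m j))) ∧
    (∀ i j, IsHomogeneousZ (koszulMatrix h i j) (b (Fin.castAdd m j) - c i)) ∧
    (∀ i j, IsHomogeneousZ (A i j) (c j - a i)) ∧
    (∀ i j, IsHomogeneousZ (C i j) (b (Fin.natAdd 3 j) - a i)) ∧
    (∀ i, IsHomogeneousZ (gammaVec h A C i) (a i))
  /-- Minimality: the entries of `ρ` and of `φ` lie in the irrelevant maximal ideal. -/
  minimal_rho : ∀ j, MvPolynomial.constantCoeff (h j) = 0
  minimal_phi : ∀ i j, MvPolynomial.constantCoeff (phiMatrix h A C i j) = 0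

end

end GenGor

/-! Write D for det(A | C). Then I(B) = I_X + (D), and I_X lies in (h₁, h₂, h₃), because a minor of
B keeping the last row vanishes modulo h. An element of I(B) ∩ (h) is thus a + cD with a in I_X and
cD in (h). If D is a nonzerodivisor modulo (h), then c is in (h). The relation given by the signed
minors of B along a column of A shows D·hⱼ ∈ I_X, so cD ∈ I_X.

That D is a nonzerodivisor modulo (h) is a depth argument. Exactness of the given resolution forces
the Koszul complex on h to be exact (`exact_koszulMatrix_left`, `exact_koszulMatrix_right`), so
R/(h) has a free resolution of length 3. The ideal (h, D) has height at least 4, hence contains a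
weakly regular sequence of length 4 (`exists_isWeaklyRegular_of_le_height`, by Nagata's change of
variables and induction on the length). A module with a free resolution of length 3 has no nonzero
element killed by such an ideal (`mem_range_of_forall_mul_mem_range`), and c is killed by (h, D)
modulo (h).

The equality of ideals passes to ideal sheaves because localization commutes with finite
intersections. -/

namespace GenGor

/-! ### Heights and regular sequences in S[X] modulo a monic polynomial -/

section RegularSequences

open RingTheory.Sequence Polynomial

/-- If `T` is integral over `S`, contracting a prime ideal does not lower its height. -/
theorem height_le_height_comap_of_isIntegral {S T : Type*} [CommRing S] [CommRing T] [Algebra S T]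
    [Algebra.IsIntegral S T] (P : Ideal T) [P.IsPrime] :
    P.height ≤ (P.comap (algebraMap S T)).height := by
  -- Incomparability: a strict chain of primes below P contracts to a strict chain.
  have hmono : StrictMono (PrimeSpectrum.comap (algebraMap S T)) := fun a b hab =>
    Ideal.IsIntegral.comap_lt_comap (I := a.asIdeal) (J := b.asIdeal) hab
  have key := Order.height_le_height_apply_of_strictMono _ hmono ⟨P, inferInstance⟩
  rwa [← PrimeSpectrum.height_eq_orderHeight, ← PrimeSpectrum.height_eq_orderHeight] at key

/-- Contracting an ideal of `S[X]` that contains a monic polynomial to `S` lowers the height by at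
most one. -/
theorem le_height_comap_C_of_monic_mem {S : Type*} [CommRing S] [IsNoetherianRing S]
    {I : Ideal S[X]} {f : S[X]} (hf : f.Monic) (hfI : f ∈ I) {c : ℕ}
    (hI : ((c + 1 : ℕ) : ℕ∞) ≤ I.height) : (c : ℕ∞) ≤ (I.comap (C : S →+* S[X])).height := by
  rw [Ideal.height_eq_inf_minimalPrimes]
  refine le_iInf₂ fun q hq => ?_
  have hqp : q.IsPrime := hq.isPrime
  have hle : I.comap (C : S →+* S[X]) ≤ q := hq.1.2
  -- S[X]/(f) is finite over S, so lying over lifts q to a prime Q containing the image of I.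
  have := hf.finite_quotient
  obtain ⟨Q, hQI, hQ, hQq⟩ := Ideal.exists_ideal_over_prime_of_isIntegral
    (S := S[X] ⧸ Ideal.span {f}) q (I.map (Ideal.Quotient.mk (Ideal.span {f}))) (by
      intro x hx
      refine hle ?_
      have hx' : Ideal.Quotient.mk (Ideal.span {f}) (C x) ∈
          I.map (Ideal.Quotient.mk (Ideal.span {f})) := hx
      rw [Ideal.mem_quotient_iff_mem] at hx'
      · exact hx'
      · rwa [Ideal.span_singleton_le_iff_mem])
  set P : Ideal S[X] := Q.comap (Ideal.Quotient.mk (Ideal.span {f})) with hP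
  have hIP : I ≤ P := Ideal.map_le_iff_le_comap.1 hQI
  have hmapP : P.map (Ideal.Quotient.mk (Ideal.span {f})) = Q :=
    Ideal.map_comap_of_surjective _ Ideal.Quotient.mk_surjective Q
  have h1 : P.height ≤ Q.height + 1 := by
    have := Ideal.height_le_height_add_one_of_mem (hIP hfI)
    rwa [hmapP] at this
  have h2 : Q.height ≤ q.height := by
    have := height_le_height_comap_of_isIntegral (S := S) Q
    rwa [hQq] at this
  have h3 : ((c + 1 : ℕ) : ℕ∞) ≤ q.height + 1 :=
    (hI.trans (Ideal.height_mono hIP)).trans (h1.trans (by gcongr))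
  push_cast at h3
  exact (ENat.add_le_add_iff_right ENat.one_ne_top).1 h3

/-- A monic polynomial followed by a weakly regular sequence of constants is weakly regular. -/
theorem isWeaklyRegular_monic_cons_map_C {S : Type*} [CommRing S] {f : S[X]} (hf : f.Monic)
    {rs : List S} (hrs : IsWeaklyRegular S rs) :
    IsWeaklyRegular S[X] (f :: rs.map (C : S →+* S[X])) := by
  have hfree := hf.free_quotient
  refine IsWeaklyRegular.cons' ?_ ?_
  · intro a b hab
    exact hf.isRegular.left hab
  · have h1 : IsWeaklyRegular (S[X] ⧸ Ideal.span {f})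
        (rs.map (algebraMap S (S[X] ⧸ Ideal.span {f}))) := hrs.of_flat
    have e : (S[X] ⧸ Ideal.span {f}) ≃ₗ[S[X]] QuotSMulTop f S[X] :=
      Submodule.quotEquivOfEq _ _ (by
        rw [← Submodule.ideal_span_singleton_smul, smul_eq_mul, Ideal.mul_top])
    rw [List.map_map]
    rw [isWeaklyRegular_map_algebraMap_iff] at h1
    have h2 : IsWeaklyRegular (S[X] ⧸ Ideal.span {f}) (rs.map (algebraMap S S[X])) := by
      rwa [isWeaklyRegular_map_algebraMap_iff]
    rw [e.isWeaklyRegular_congr] at h2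
    rw [← List.map_map]
    exact (isWeaklyRegular_map_algebraMap_iff (S[X] ⧸ Ideal.span {f}) _ _).2 h2

theorem isWeaklyRegular_replicate_one {R : Type*} [CommRing R] (c : ℕ) :
    IsWeaklyRegular R (List.replicate c (1 : R)) := by
  refine ⟨fun i hi => ?_⟩
  rw [List.getElem_replicate]
  exact IsSMulRegular.one _

end RegularSequences

end GenGor

namespace GenGor

/-! ### Nagata's change of variables -/

section Nagata

open Polynomial MvPolynomial

variable {k : Type*} [Field k] {n : ℕ}

/-- The endomorphism `X₀ ↦ X₀`, `Xᵢ ↦ Xᵢ + c X₀ ^ (N ^ i)` of the polynomial ring. -/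
noncomputable def nagataHom (N : ℕ) (c : k) :
    MvPolynomial (Fin (n + 1)) k →ₐ[k] MvPolynomial (Fin (n + 1)) k :=
  aeval fun i => if i = 0 then X 0 else X i + c • X 0 ^ (N ^ (i : ℕ))

theorem nagataHom_comp_neg (N : ℕ) (c : k) :
    (nagataHom (n := n) N c).comp (nagataHom N (-c)) = AlgHom.id _ _ := by
  rw [nagataHom, nagataHom, comp_aeval, ← MvPolynomial.aeval_X_left]
  ext i v
  cases i using Fin.cases <;> simp

/-- Nagata's change of variables `Xᵢ ↦ Xᵢ + X₀ ^ (N ^ i)`. -/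
noncomputable def nagataEquiv (N : ℕ) :
    MvPolynomial (Fin (n + 1)) k ≃ₐ[k] MvPolynomial (Fin (n + 1)) k :=
  AlgEquiv.ofAlgHom (nagataHom N 1) (nagataHom N (-1))
    (nagataHom_comp_neg N 1) (by simpa using nagataHom_comp_neg (k := k) (n := n) N (-1))

theorem finSuccEquiv_nagataEquiv_X_zero (N : ℕ) :
    finSuccEquiv k n (nagataEquiv N (X 0)) = Polynomial.X := by
  simp [nagataEquiv, nagataHom, finSuccEquiv_X_zero]

theorem finSuccEquiv_nagataEquiv_X_succ (N : ℕ) (i : Fin n) :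
    finSuccEquiv k n (nagataEquiv N (X i.succ)) =
      Polynomial.X ^ (N ^ (i.succ : ℕ)) + Polynomial.C (X i) := by
  simp [nagataEquiv, nagataHom, finSuccEquiv_X_zero, finSuccEquiv_X_succ, add_comm]

theorem monic_and_natDegree_finSuccEquiv_nagataEquiv_X {N : ℕ} (hN : 0 < N)
    (i : Fin (n + 1)) :
    (finSuccEquiv k n (nagataEquiv N (X i))).Monic ∧
      (finSuccEquiv k n (nagataEquiv N (X i))).natDegree = N ^ (i : ℕ) := by
  cases i using Fin.cases with
  | zero =>
    rw [finSuccEquiv_nagataEquiv_X_zero]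
    simp [Polynomial.monic_X]
  | succ i =>
    rw [finSuccEquiv_nagataEquiv_X_succ]
    exact ⟨Polynomial.monic_X_pow_add_C _ (pow_pos hN _).ne', Polynomial.natDegree_X_pow_add_C⟩

theorem finSuccEquiv_nagataEquiv_monomial (N : ℕ) (v : Fin (n + 1) →₀ ℕ) (a : k) :
    finSuccEquiv k n (nagataEquiv N (monomial v a)) =
      Polynomial.C (MvPolynomial.C a) * ∏ i, finSuccEquiv k n (nagataEquiv N (X i)) ^ v i := by
  rw [monomial_eq, Finsupp.prod_fintype _ _ fun i => pow_zero _]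
  simp only [map_mul, map_prod, map_pow]
  congr 1
  rw [← MvPolynomial.algebraMap_eq, AlgEquiv.commutes, AlgEquiv.commutes]
  rfl

theorem leadingCoeff_finSuccEquiv_nagataEquiv_monomial {N : ℕ} (hN : 0 < N)
    (v : Fin (n + 1) →₀ ℕ) (a : k) :
    (finSuccEquiv k n (nagataEquiv N (monomial v a))).leadingCoeff = MvPolynomial.C a := by
  have hm : (∏ i, finSuccEquiv k n (nagataEquiv N (X i)) ^ v i).Monic :=
    Polynomial.monic_prod_of_monic _ _ fun i _ =>
      (monic_and_natDegree_finSuccEquiv_nagataEquiv_X hN i).1.pow _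
  rw [finSuccEquiv_nagataEquiv_monomial, Polynomial.leadingCoeff_mul_monic hm,
    Polynomial.leadingCoeff_C]

theorem natDegree_finSuccEquiv_nagataEquiv_monomial {N : ℕ} (hN : 0 < N)
    (v : Fin (n + 1) →₀ ℕ) {a : k} (ha : a ≠ 0) :
    (finSuccEquiv k n (nagataEquiv N (monomial v a))).natDegree =
      ∑ i : Fin (n + 1), N ^ (i : ℕ) * v i := by
  have hX := fun i => monic_and_natDegree_finSuccEquiv_nagataEquiv_X (k := k) (n := n) hN i
  have hm : (∏ i, finSuccEquiv k n (nagataEquiv N (X i)) ^ v i).Monic :=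
    Polynomial.monic_prod_of_monic _ _ fun i _ => (hX i).1.pow _
  rw [finSuccEquiv_nagataEquiv_monomial,
    Polynomial.natDegree_C_mul_of_mul_ne_zero (by rw [hm.leadingCoeff, mul_one]; simpa using ha),
    Polynomial.natDegree_prod_of_monic _ _ fun i _ => (hX i).1.pow _]
  refine Finset.sum_congr rfl fun i _ => ?_
  rw [(hX i).1.natDegree_pow, (hX i).2, mul_comm]

/-- Base `N` expansions are unique. -/
theorem eq_of_sum_pow_mul_eq {N : ℕ} (hN : 1 < N) {v w : Fin (n + 1) →₀ ℕ}
    (hv : ∀ i, v i < N) (hw : ∀ i, w i < N)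
    (h : ∑ i : Fin (n + 1), N ^ (i : ℕ) * v i = ∑ i : Fin (n + 1), N ^ (i : ℕ) * w i) : v = w := by
  refine Finsupp.ext <| congrFun <| List.ofFn_inj.mp ?_
  apply Nat.ofDigits_inj_of_len_eq hN (by simp) (List.forall_mem_ofFn_iff.2 hv)
    (List.forall_mem_ofFn_iff.2 hw)
  simpa only [Nat.ofDigits_eq_sum_mapIdx, List.mapIdx_eq_ofFn, List.get_ofFn, List.length_ofFn,
    Fin.val_cast, mul_comm, List.sum_ofFn] using! h

/-- After a suitable change of variables, a nonzero polynomial becomes monic, up to a unit, in the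
first variable. -/
theorem exists_isUnit_leadingCoeff_finSuccEquiv {f : MvPolynomial (Fin (n + 1)) k} (hf : f ≠ 0) :
    ∃ e : MvPolynomial (Fin (n + 1)) k ≃ₐ[k] MvPolynomial (Fin (n + 1)) k,
      IsUnit (finSuccEquiv k n (e f)).leadingCoeff := by
  classical
  -- N exceeds every exponent in f, so exponent vectors are digits in base N; the summand 2 keeps N
  -- > 1 for constant f.
  set N := 2 + f.totalDegree with hNdef
  have hN0 : 0 < N := by omega
  have hlt : ∀ v ∈ f.support, ∀ i, v i < N := fun v hv i =>
    lt_of_le_of_lt ((monomial_le_degreeOf i hv).trans (degreeOf_le_totalDegree f i)) (by omega)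
  refine ⟨nagataEquiv N, ?_⟩
  set t : (Fin (n + 1) →₀ ℕ) → (MvPolynomial (Fin n) k)[X] := fun v =>
    finSuccEquiv k n (nagataEquiv N (monomial v (coeff v f))) with ht
  obtain ⟨v, hv, hmax⟩ := Finset.exists_max_image f.support (fun v => (t v).natDegree)
    (support_nonempty.mpr hf)
  have hlc : (t v).leadingCoeff = MvPolynomial.C (coeff v f) :=
    leadingCoeff_finSuccEquiv_nagataEquiv_monomial hN0 v _
  have hdeg : ∀ w ∈ f.support, (t w).natDegree = ∑ i : Fin (n + 1), N ^ (i : ℕ) * w i :=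
    fun w hw => natDegree_finSuccEquiv_nagataEquiv_monomial hN0 w (mem_support_iff.1 hw)
  have htv : t v ≠ 0 := by
    rw [← Polynomial.leadingCoeff_ne_zero, hlc]
    simpa using mem_support_iff.1 hv
  -- Distinct monomials have images of distinct degrees, so the top term cannot cancel.
  have hsmall : (∑ w ∈ f.support.erase v, t w).degree < (t v).degree := by
    refine lt_of_le_of_lt (Polynomial.degree_sum_le _ _) ?_
    refine (Finset.sup_lt_iff (bot_lt_iff_ne_bot.2 (by rwa [ne_eq, Polynomial.degree_eq_bot]))).2
      fun w hw => ?_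
    obtain ⟨hne, hw⟩ := Finset.mem_erase.1 hw
    refine Polynomial.degree_lt_degree (lt_of_le_of_ne (hmax w hw) fun h => hne ?_)
    exact eq_of_sum_pow_mul_eq (by omega) (hlt w hw) (hlt v hv) (by rw [← hdeg w hw, ← hdeg v hv, h])
  have hsum : finSuccEquiv k n (nagataEquiv N f) = (∑ w ∈ f.support.erase v, t w) + t v := by
    rw [Finset.sum_erase_add _ _ hv]
    conv_lhs => rw [← f.support_sum_monomial_coeff]
    rw [map_sum, map_sum]
  rw [hsum, Polynomial.leadingCoeff_add_of_degree_lt hsmall, hlc]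
  exact (mem_support_iff.1 hv).isUnit.map MvPolynomial.C

end Nagata

/-! ### Regular sequences in ideals of polynomial rings -/

section RegularSequences

open RingTheory.Sequence

/-- The existence, in every ideal of height at least `c`, of a weakly regular sequence of length
`c` is invariant under ring isomorphisms. -/
theorem exists_isWeaklyRegular_of_ringEquiv {R S : Type*} [CommRing R] [CommRing S] (e : R ≃+* S)
    {I : Ideal R} {ss : List S} (hmem : ∀ s ∈ ss, s ∈ I.map e) (hss : IsWeaklyRegular S ss) :
    ∃ rs : List R, rs.length = ss.length ∧ (∀ r ∈ rs, r ∈ I) ∧ IsWeaklyRegular R rs := by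
  refine ⟨ss.map e.symm, by simp, ?_, ?_⟩
  · intro r hr
    obtain ⟨s, hs, rfl⟩ := List.mem_map.1 hr
    have := hmem s hs
    obtain ⟨x, hx, rfl⟩ := (Ideal.mem_map_of_equiv e s).1 this
    rwa [RingEquiv.symm_apply_apply]
  · refine (e.symm.toAddEquiv.isWeaklyRegular_congr (as := ss) (bs := ss.map e.symm) ?_).1 hss
    rw [List.forall₂_map_right_iff, List.forall₂_same]
    intro s _ x
    exact map_mul e.symm s x

/-- Polynomial rings over fields are Cohen-Macaulay: an ideal of height at least `c` contains a
weakly regular sequence of length `c`. -/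
theorem exists_isWeaklyRegular_of_le_height {k : Type*} [Field k] (c : ℕ) : ∀ (n : ℕ)
    (I : Ideal (MvPolynomial (Fin n) k)), (c : ℕ∞) ≤ I.height →
    ∃ rs : List (MvPolynomial (Fin n) k), rs.length = c ∧ (∀ r ∈ rs, r ∈ I) ∧
      IsWeaklyRegular (MvPolynomial (Fin n) k) rs := by
  induction c with
  | zero => exact fun n I _ => ⟨[], rfl, by simp, by simp⟩
  | succ c ih =>
    intro n I hI
    have hbot : I ≠ ⊥ := by
      rintro rfl
      rw [Ideal.height_bot] at hI
      simp at hI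
    obtain ⟨f, hfI, hf0⟩ := Submodule.exists_mem_ne_zero_of_ne_bot hbot
    cases n with
    | zero =>
      -- Over a field a nonzero ideal is the unit ideal; weak regularity allows the constant
      -- sequence 1.
      have h1 : (1 : MvPolynomial (Fin 0) k) ∈ I := by
        rw [← Ideal.eq_top_iff_one]
        refine Ideal.eq_top_of_isUnit_mem _ hfI ?_
        rw [MvPolynomial.eq_C_of_isEmpty f]
        refine IsUnit.map _ (IsUnit.mk0 _ fun h => hf0 ?_)
        rw [MvPolynomial.eq_C_of_isEmpty f, h, map_zero]
      refine ⟨List.replicate (c + 1) 1, by simp, fun r hr => ?_, isWeaklyRegular_replicate_one _⟩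
      rwa [(List.mem_replicate.1 hr).2]
    | succ n =>
      obtain ⟨e, he⟩ := exists_isUnit_leadingCoeff_finSuccEquiv hf0
      set E : MvPolynomial (Fin (n + 1)) k ≃+* Polynomial (MvPolynomial (Fin n) k) :=
        (e.trans (MvPolynomial.finSuccEquiv k n)).toRingEquiv with hE
      have hmonic := Polynomial.monic_of_isUnit_leadingCoeff_inv_smul he
      set g := he.unit⁻¹ • MvPolynomial.finSuccEquiv k n (e f) with hg
      have hgI : g ∈ I.map E := by
        rw [hg, Units.smul_def]
        exact Submodule.smul_of_tower_mem _ _ (Ideal.mem_map_of_mem E hfI)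
      have hht : ((c + 1 : ℕ) : ℕ∞) ≤ (I.map E).height := by
        rwa [RingEquiv.height_map]
      obtain ⟨rs, hlen, hrs, hreg⟩ := ih n _ (le_height_comap_C_of_monic_mem hmonic hgI hht)
      obtain ⟨ss, h1, h2, h3⟩ := exists_isWeaklyRegular_of_ringEquiv E (I := I)
        (ss := g :: rs.map Polynomial.C) (by
          intro s hs
          rcases List.mem_cons.1 hs with rfl | hs
          · exact hgI
          · obtain ⟨r, hr, rfl⟩ := List.mem_map.1 hs
            exact hrs r hr)
        (isWeaklyRegular_monic_cons_map_C hmonic hreg)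
      exact ⟨ss, by simp [h1, hlen], h2, h3⟩

theorem mem_ofList_cons {R : Type*} [CommRing R] {a x : R} {l : List R} :
    x ∈ Ideal.ofList (a :: l) ↔ ∃ p, ∃ y ∈ Ideal.ofList l, x = a * p + y := by
  rw [Ideal.ofList_cons, Submodule.mem_sup]
  constructor
  · rintro ⟨_, hz, y, hy, rfl⟩
    obtain ⟨p, rfl⟩ := Ideal.mem_span_singleton'.1 hz
    exact ⟨p, y, hy, by rw [mul_comm]⟩
  · rintro ⟨p, y, hy, rfl⟩
    exact ⟨a * p, Ideal.mul_mem_right _ _ (Ideal.mem_span_singleton_self a), y, hy, rfl⟩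

/-- Membership form of weak regularity. -/
theorem mem_ofList_take_of_mul_mem {R : Type*} [CommRing R] {rs : List R}
    (h : IsWeaklyRegular R rs) (i : ℕ) (hi : i < rs.length) {x : R}
    (hx : rs[i] * x ∈ Ideal.ofList (rs.take i)) : x ∈ Ideal.ofList (rs.take i) := by
  have htop : (Ideal.ofList (rs.take i) • ⊤ : Submodule R R) = Ideal.ofList (rs.take i) := by
    rw [smul_eq_mul, Ideal.mul_top]
  have := mem_of_isSMulRegular_quotient_of_smul_mem (x := x) (h.regular_mod_prev i hi)
    (by rw [htop]; exact hx)
  rwa [htop] at this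

end RegularSequences

end GenGor

namespace GenGor

/-! ### Depth against the length of a free resolution -/

section Descent

variable {R : Type*} [CommRing R] {ι : Type*}

theorem eq_zero_of_smul_eq_zero_pi {g : R} (hg : ∀ x, g * x = 0 → x = 0)
    (v : ι → R) (hv : g • v = 0) : v = 0 :=
  funext fun i => hg _ (congrFun hv i)

theorem exists_smul_eq_pi {g₁ g₂ : R} (hg : ∀ x y, g₂ * x = g₁ * y → ∃ z, x = g₁ * z)
    (v w : ι → R) (hv : g₂ • v = g₁ • w) : ∃ z, v = g₁ • z := by
  choose z hz using fun i => hg (v i) (w i) (congrFun hv i)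
  exact ⟨z, funext hz⟩

theorem exists_smul_add_smul_eq_pi {g₁ g₂ g₃ : R}
    (hg : ∀ x y z, g₃ * x = g₁ * y + g₂ * z → ∃ p q, x = g₁ * p + g₂ * q)
    (u v w : ι → R) (hv : g₃ • u = g₁ • v + g₂ • w) : ∃ p q, u = g₁ • p + g₂ • q := by
  choose p q hz using fun i => hg (u i) (v i) (w i) (congrFun hv i)
  exact ⟨p, q, funext hz⟩

/-- Let `0 → R → R^ι₂ → R^ι₁ → R` be exact with last map `d₁`, and let `I` be an ideal
containing a weakly regular sequence of length four. Then the cokernel of `d₁` has no nonzero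
element annihilated by `I`. -/
theorem mem_range_of_forall_mul_mem_range {ι₁ ι₂ : Type*}
    {d₁ : (ι₁ → R) →ₗ[R] R} {d₂ : (ι₂ → R) →ₗ[R] (ι₁ → R)} {d₃ : R →ₗ[R] (ι₂ → R)}
    (h₁ : Function.Exact d₂ d₁) (h₂ : Function.Exact d₃ d₂) (h₃ : Function.Injective d₃)
    {I : Ideal R} {g₁ g₂ g₃ g₄ : R} (m₁ : g₁ ∈ I) (m₂ : g₂ ∈ I) (m₃ : g₃ ∈ I) (m₄ : g₄ ∈ I)
    (r₁ : ∀ x, g₁ * x = 0 → x = 0)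
    (r₂ : ∀ x y, g₂ * x = g₁ * y → ∃ z, x = g₁ * z)
    (r₃ : ∀ x y z, g₃ * x = g₁ * y + g₂ * z → ∃ p q, x = g₁ * p + g₂ * q)
    (r₄ : ∀ x y z w, g₄ * x = g₁ * y + g₂ * z + g₃ * w →
      ∃ p q s, x = g₁ * p + g₂ * q + g₃ * s)
    {c : R} (hc : ∀ b ∈ I, ∃ u, d₁ u = b * c) : ∃ u, d₁ u = c := by
  have c₁ : ∀ v, d₁ (d₂ v) = 0 := h₁.apply_apply_eq_zero
  have c₂ : ∀ v, d₂ (d₃ v) = 0 := h₂.apply_apply_eq_zero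
  have e₁ : ∀ v, d₁ v = 0 → ∃ t, d₂ t = v := fun v hv => (h₁ v).1 hv
  have e₂ : ∀ v, d₂ v = 0 → ∃ t, d₃ t = v := fun v hv => (h₂ v).1 hv
  have f₁ : ∀ v, d₁ (g₁ • v) = 0 → ∃ t, d₂ t = v := fun v hv =>
    e₁ v (r₁ _ (by simpa using hv))
  have f₂ : ∀ v, d₂ (g₁ • v) = 0 → ∃ t, d₃ t = v := fun v hv =>
    e₂ v (eq_zero_of_smul_eq_zero_pi r₁ _ (by simpa using hv))
  -- descend to `R^ι₁` modulo `g₁`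
  obtain ⟨v, hv⟩ := hc g₁ m₁
  have hv' : ∀ b ∈ I, ∃ u t, b • v = g₁ • u + d₂ t := by
    intro b hb
    obtain ⟨u, hu⟩ := hc b hb
    obtain ⟨t, ht⟩ := e₁ (b • v - g₁ • u) (by
      simp only [map_sub, map_smul, hv, hu, smul_eq_mul]; ring)
    exact ⟨u, t, by rw [ht]; abel⟩
  -- descend to `R^ι₂` modulo `g₁, g₂`
  obtain ⟨u, w, hw⟩ := hv' g₂ m₂
  have hw' : ∀ b ∈ I, ∃ p q e, b • w = g₁ • p + g₂ • q + d₃ e := by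
    intro b hb
    obtain ⟨ub, tb, htb⟩ := hv' b hb
    have key : d₂ (b • w - g₂ • tb) = g₁ • (g₂ • ub - b • u) := by
      have a₁ : d₂ w = g₂ • v - g₁ • u := by rw [hw]; abel
      have a₂ : d₂ tb = b • v - g₁ • ub := by rw [htb]; abel
      rw [map_sub, map_smul, map_smul, a₁, a₂]
      module
    obtain ⟨x, hx⟩ := f₁ (g₂ • ub - b • u) (by rw [← key, c₁])
    obtain ⟨e, he⟩ := e₂ (b • w - g₂ • tb - g₁ • x) (by
      rw [map_sub, key, map_smul, hx, sub_self])
    exact ⟨x, tb, e, by rw [he]; module⟩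
  -- descend to `R` modulo `g₁, g₂, g₃`
  have tor : ∀ x y z, d₃ x = g₁ • y + g₂ • z → ∃ p q, x = g₁ * p + g₂ * q := by
    intro x y z hx
    have k₁ : g₂ • d₂ z = g₁ • d₂ (-y) := by
      have := c₂ x
      rw [hx, map_add, map_smul, map_smul] at this
      rw [map_neg, smul_neg, eq_neg_iff_add_eq_zero, add_comm, this]
    obtain ⟨y', hy'⟩ := exists_smul_eq_pi r₂ _ _ k₁
    obtain ⟨x', hx'⟩ := f₁ y' (by rw [← hy', c₁])
    obtain ⟨s, hs⟩ := e₂ (z - g₁ • x') (by rw [map_sub, map_smul, hx', hy', sub_self])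
    have k₂ : d₃ (x - g₂ * s) = g₁ • (y + g₂ • x') := by
      rw [← smul_eq_mul, map_sub, map_smul, hs, hx]
      module
    obtain ⟨s', hs'⟩ := f₂ (y + g₂ • x') (by rw [← k₂, c₂])
    refine ⟨s', s, ?_⟩
    have : x - g₂ * s = g₁ * s' := h₃ (by rw [k₂, ← hs', ← smul_eq_mul, map_smul])
    linear_combination this
  obtain ⟨p, q, d, hd⟩ := hw' g₃ m₃
  -- The last obstruction d lives in R/(g₁, g₂, g₃), where it is killed by g₄, a nonzerodivisor
  -- there.
  obtain ⟨d₁', d₂', d₃', hd'⟩ : ∃ x y z, d = g₁ * x + g₂ * y + g₃ * z := by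
    obtain ⟨p', q', e, he⟩ := hw' g₄ m₄
    obtain ⟨x, y, hxy⟩ := tor (g₄ * d - g₃ * e) (g₃ • p' - g₄ • p) (g₃ • q' - g₄ • q) (by
      have a₁ : d₃ d = g₃ • w - (g₁ • p + g₂ • q) := by rw [hd]; abel
      have a₂ : d₃ e = g₄ • w - (g₁ • p' + g₂ • q') := by rw [he]; abel
      rw [← smul_eq_mul, ← smul_eq_mul, map_sub, map_smul, map_smul, a₁, a₂]
      module)
    exact r₄ d x y e (by linear_combination hxy)
  -- climb back
  obtain ⟨p', q', hpq⟩ := exists_smul_add_smul_eq_pi r₃ (w - d₃ d₃') (p + d₃ d₁') (q + d₃ d₂') (by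
    rw [smul_sub, hd, hd', ← smul_eq_mul, ← smul_eq_mul, ← smul_eq_mul]
    simp only [map_add, map_smul]
    module)
  obtain ⟨v', hv''⟩ := exists_smul_eq_pi r₂ (v - d₂ q') (u + d₂ p') (by
    have a : w = g₁ • p' + g₂ • q' + d₃ d₃' := by rw [← hpq]; abel
    rw [smul_sub, hw, a]
    simp only [map_add, map_smul, c₂]
    module)
  refine ⟨v', ?_⟩
  have : g₁ * (c - d₁ v') = 0 := by
    have := congrArg d₁ hv''
    rw [map_sub, c₁, hv, map_smul, smul_eq_mul] at this
    linear_combination this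
  rw [← sub_eq_zero.1 (r₁ _ this)]

end Descent

/-! ### Exactness of the Koszul complex on h -/

section Koszul

variable {R : Type*} [CommRing R] {m : ℕ}

theorem koszulMatrix_mulVec (h v : Fin 3 → R) :
    (koszulMatrix h).mulVec v =
      ![h 2 * v 1 - h 1 * v 2, h 0 * v 2 - h 2 * v 0, h 1 * v 0 - h 0 * v 1] := by
  ext i
  fin_cases i <;> simp [koszulMatrix, Matrix.mulVec, dotProduct, Fin.sum_univ_three] <;> ring

theorem append_smul_zero (a : R) (v : Fin 3 → R) :
    Fin.append (a • v) (0 : Fin m → R) = a • Fin.append v (0 : Fin m → R) := by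
  ext i
  refine Fin.addCases (fun i => ?_) (fun i => ?_) i <;> simp

theorem append_sub_zero (v w : Fin 3 → R) :
    Fin.append (v - w) (0 : Fin m → R) = Fin.append v (0 : Fin m → R) - Fin.append w 0 := by
  ext i
  refine Fin.addCases (fun i => ?_) (fun i => ?_) i <;> simp

theorem append_injective_left {v w : Fin 3 → R}
    (e : Fin.append v (0 : Fin m → R) = Fin.append w 0) : v = w := by
  ext i
  simpa using congrFun e (Fin.castAdd m i)

theorem rhoMap_apply (h : Fin 3 → R) (a : R) :
    rhoMap m h a = a • Fin.append h (0 : Fin m → R) := rfl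

variable [IsDomain R] {h : Fin 3 → R} {F : Type*} [AddCommGroup F] [Module R F]
  [Module.IsTorsionFree R F] {φ : (Fin (3 + m) → R) →ₗ[R] F}

theorem exists_ne_zero_of_injective_rhoMap (hρ : Function.Injective (rhoMap m h)) :
    ∃ i, h i ≠ 0 := by
  by_contra! hcon
  have h0 : h = 0 := funext hcon
  refine one_ne_zero (α := R) (hρ ?_)
  rw [map_zero, rhoMap_apply, one_smul, h0]
  ext i
  refine Fin.addCases (fun i => ?_) (fun i => ?_) i <;> simp

/-- If `0 → R → R³ ⊕ R^m → F` is exact with first map `(h, 0)` and `F` is torsion free, then every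
vector proportional to `h` is a multiple of `h`. -/
theorem exists_eq_smul_of_proportional (hρ : Function.Injective (rhoMap m h))
    (hφ : Function.Exact (rhoMap m h) φ) {v : Fin 3 → R}
    (hv : ∀ i j, v i * h j = v j * h i) : ∃ y : R, v = y • h := by
  obtain ⟨i, hi⟩ := exists_ne_zero_of_injective_rhoMap hρ
  have hvec : h i • Fin.append v (0 : Fin m → R) = v i • Fin.append h (0 : Fin m → R) := by
    rw [← append_smul_zero, ← append_smul_zero]
    congr 1
    ext j
    simp only [Pi.smul_apply, smul_eq_mul]
    linear_combination -(hv i j)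
  -- h i • (v, 0) is in the image of ρ, so φ kills it; torsion-freeness removes the factor h i.
  have h0 : φ (Fin.append v 0) = 0 := by
    refine (smul_eq_zero.1 (?_ : h i • φ (Fin.append v 0) = 0)).resolve_left hi
    rw [← map_smul, hvec, map_smul, ← one_smul R (Fin.append h (0 : Fin m → R)),
      ← rhoMap_apply, hφ.apply_apply_eq_zero, smul_zero]
  obtain ⟨y, hy⟩ := (hφ _).1 h0
  refine ⟨y, append_injective_left (m := m) ?_⟩
  rw [append_smul_zero, ← rhoMap_apply, hy]

theorem exact_koszulMatrix_left (hρ : Function.Injective (rhoMap m h))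
    (hφ : Function.Exact (rhoMap m h) φ) :
    Function.Exact (LinearMap.toSpanSingleton R (Fin 3 → R) h) (koszulMatrix h).mulVecLin := by
  intro v
  rw [Matrix.mulVecLin_apply, koszulMatrix_mulVec]
  constructor
  · intro hv
    have h0 := congrFun hv 0
    have h1 := congrFun hv 1
    have h2 := congrFun hv 2
    simp only [Matrix.cons_val, Pi.zero_apply] at h0 h1 h2
    obtain ⟨y, hy⟩ := exists_eq_smul_of_proportional (v := v) hρ hφ (by
      intro i j
      fin_cases i <;> fin_cases j <;> simp only [Fin.zero_eta, Fin.mk_one, Fin.reduceFinMk] <;>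
        grind)
    exact ⟨y, by rw [hy, LinearMap.toSpanSingleton_apply]⟩
  · rintro ⟨y, rfl⟩
    ext i
    fin_cases i <;> simp <;> ring

/-- If `0 → R → R³ ⊕ R^m → R^ι → R` is exact with first map `(h, 0)`, then all relations among
`h₁, h₂, h₃` are Koszul relations. -/
theorem exact_koszulMatrix_right {ι : Type*} {φ : (Fin (3 + m) → R) →ₗ[R] (ι → R)}
    {γ : (ι → R) →ₗ[R] R} (hρ : Function.Injective (rhoMap m h))
    (hφ : Function.Exact (rhoMap m h) φ) (hγ : Function.Exact φ γ) :
    Function.Exact (koszulMatrix h).mulVecLin (Fintype.linearCombination R h) := by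
  intro c
  rw [Fintype.linearCombination_apply, Fin.sum_univ_three]
  simp only [smul_eq_mul]
  constructor
  swap
  · rintro ⟨v, rfl⟩
    rw [Matrix.mulVecLin_apply, koszulMatrix_mulVec]
    simp only [Matrix.cons_val]
    ring
  intro hc
  -- Rows of the cross-product matrix of c. Since c · h = 0, each difference h i • w j - h j • w i
  -- below is a multiple of h, which φ kills.
  let w : Fin 3 → Fin 3 → R := ![![0, c 2, -c 1], ![-c 2, 0, c 0], ![c 1, -c 0, 0]]
  have w₀ : h 2 • w 1 - h 1 • w 2 = c 0 • h := by
    ext l; fin_cases l <;> simp [w] <;> grind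
  have w₁ : h 0 • w 2 - h 2 • w 0 = c 1 • h := by
    ext l; fin_cases l <;> simp [w] <;> grind
  have w₂ : h 1 • w 0 - h 0 • w 1 = c 2 • h := by
    ext l; fin_cases l <;> simp [w] <;> grind
  let W : Fin 3 → Fin (3 + m) → R := fun i => Fin.append (w i) 0
  have hW : ∀ {i j : Fin 3} {a : R}, h i • w j - h j • w i = a • h →
      h i • φ (W j) = h j • φ (W i) := by
    intro i j a e
    rw [← sub_eq_zero, ← map_smul, ← map_smul, ← map_sub, ← append_smul_zero, ← append_smul_zero,
      ← append_sub_zero, e, append_smul_zero, ← rhoMap_apply, hφ.apply_apply_eq_zero]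
  have e₀ := hW w₀
  have e₁ := hW w₁
  have e₂ := hW w₂
  -- For fixed l, the l-th coordinates of the three vectors φ (W i) form a vector proportional to h.
  have hprop : ∀ l, ∃ y : R, (fun i => φ (W i) l) = y • h := fun l =>
    exists_eq_smul_of_proportional hρ hφ (by
      have e₀ := congrFun e₀ l
      have e₁ := congrFun e₁ l
      have e₂ := congrFun e₂ l
      simp only [Pi.smul_apply, smul_eq_mul] at e₀ e₁ e₂
      intro i j
      fin_cases i <;> fin_cases j <;> simp only [Fin.zero_eta, Fin.mk_one, Fin.reduceFinMk] <;>
        grind)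
  choose y hy using hprop
  have hWy : ∀ i, φ (W i) = h i • y := fun i => funext fun l => by
    have := congrFun (hy l) i
    simpa [mul_comm] using this
  obtain ⟨i₀, hi₀⟩ := exists_ne_zero_of_injective_rhoMap hρ
  have hγy : γ y = 0 := by
    refine (smul_eq_zero.1 (?_ : h i₀ • γ y = 0)).resolve_left hi₀
    rw [← map_smul, ← hWy, hγ.apply_apply_eq_zero]
  obtain ⟨u, hu⟩ := (hγ y).1 hγy
  -- Lifting y to u makes W i - h i • u a cycle, hence a i • ρ(1); the multiples of u cancel in the
  -- cross differences, exhibiting c as a Koszul relation.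
  have ha : ∀ i, ∃ a, rhoMap m h a = W i - h i • u := fun i =>
    (hφ _).1 (by rw [map_sub, map_smul, hu, hWy, sub_self])
  choose a ha using ha
  have hcoef : ∀ {i j : Fin 3} {b : R}, h i • w j - h j • w i = b • h →
      b = h i * a j - h j * a i := by
    intro i j b e
    refine hρ ?_
    rw [map_sub, ← smul_eq_mul, ← smul_eq_mul, map_smul, map_smul, ha, ha, rhoMap_apply,
      ← append_smul_zero, ← e, append_sub_zero, append_smul_zero, append_smul_zero]
    module
  refine ⟨a, ?_⟩
  rw [Matrix.mulVecLin_apply, koszulMatrix_mulVec, ← hcoef w₀, ← hcoef w₁, ← hcoef w₂]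
  ext i
  fin_cases i <;> rfl

end Koszul
end GenGor

namespace GenGor

/-! ### Minors of B and the ideals they generate -/

section Minors

variable {R : Type*} [CommRing R] {m n : ℕ}

/-- The signed maximal minors of an `(n+1) × n` matrix are a relation among its rows. -/
theorem sum_signedMinor_mul (B : Matrix (Fin (n + 1)) (Fin n) R) (j : Fin n) :
    ∑ i, signedMinor B i * B i j = 0 := by
  -- Column j is repeated in front; Laplace expansion along it gives the relation, up to the overall
  -- sign in `signedMinor`.
  let M : Matrix (Fin (n + 1)) (Fin (n + 1)) R := Matrix.of fun i => Fin.cons (B i j) (B i)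
  have hM : M.det = 0 :=
    Matrix.det_zero_of_column_eq (i := 0) (j := j.succ) (Fin.succ_ne_zero j).symm fun i => by
      simp [M]
  rw [Matrix.det_succ_column M 0] at hM
  rw [← neg_eq_zero, ← hM, ← Finset.sum_neg_distrib]
  refine Finset.sum_congr rfl fun i _ => ?_
  have hsub : M.submatrix i.succAbove (Fin.succAbove 0) = B.submatrix i.succAbove id := by
    ext a b
    simp [M]
  rw [hsub, signedMinor]
  simp only [M, Matrix.of_apply, Fin.cons_zero, Fin.val_zero, add_zero]
  ring

variable (h : Fin 3 → R) (A : Matrix (Fin (3 + m)) (Fin 3) R) (C : Matrix (Fin (3 + m)) (Fin m) R)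

theorem bMatrix_castSucc (i : Fin (3 + m)) : bMatrix h A C i.castSucc = blockMatrix A C i := by
  exact Fin.snoc_castSucc (α := fun _ => Fin (3 + m) → R) _ _ i

theorem bMatrix_last : bMatrix h A C (Fin.last _) = rhoVec m h := by
  exact Fin.snoc_last (α := fun _ => Fin (3 + m) → R) _ _

theorem signedMinor_bMatrix_last :
    signedMinor (bMatrix h A C) (Fin.last _) = (-1) ^ (3 + m + 1) * (blockMatrix A C).det := by
  rw [signedMinor, Fin.val_last]
  congr 2
  ext i j
  rw [Matrix.submatrix_apply, Fin.succAbove_last, bMatrix_castSucc, id]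

/-- The minors of `B` that involve the last row lie in the ideal generated by that row. -/
theorem gammaVec_mem_idealRho (i : Fin (3 + m)) : gammaVec h A C i ∈ idealRho h := by
  rw [gammaVec, signedMinor]
  refine Ideal.mul_mem_left _ _ ?_
  rw [← Ideal.Quotient.eq_zero_iff_mem, RingHom.map_det]
  obtain ⟨l, hl⟩ := Fin.exists_succAbove_eq (Fin.castSucc_lt_last i).ne'
  refine Matrix.det_eq_zero_of_row_eq_zero l fun j => ?_
  rw [RingHom.mapMatrix_apply, Matrix.map_apply, Matrix.submatrix_apply, hl, bMatrix_last, rhoVec,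
    Ideal.Quotient.eq_zero_iff_mem, id]
  refine Fin.addCases (fun j => ?_) (fun j => ?_) j
  · rw [Fin.append_left]
    exact Ideal.subset_span ⟨j, rfl⟩
  · rw [Fin.append_right]
    exact Ideal.zero_mem _

theorem range_gammaMap_le_idealRho : LinearMap.range (gammaMap h A C) ≤ idealRho h := by
  rintro _ ⟨v, rfl⟩
  rw [gammaMap, Fintype.linearCombination_apply]
  exact Ideal.sum_mem _ fun i _ => Ideal.mul_mem_left _ _ (gammaVec_mem_idealRho h A C i)

theorem range_gammaMap_le_idealB : LinearMap.range (gammaMap h A C) ≤ idealB h A C := by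
  rintro _ ⟨v, rfl⟩
  rw [gammaMap, Fintype.linearCombination_apply]
  exact Ideal.sum_mem _ fun i _ => Ideal.mul_mem_left _ _ (Ideal.subset_span ⟨_, rfl⟩)

theorem idealB_le : idealB h A C ≤ LinearMap.range (gammaMap h A C) ⊔ idealDet A C := by
  rw [idealB, Ideal.span_le]
  rintro _ ⟨i, rfl⟩
  refine Fin.lastCases ?_ (fun i => ?_) i
  · rw [signedMinor_bMatrix_last]
    exact Ideal.mem_sup_right (Ideal.mul_mem_left _ _ (Ideal.mem_span_singleton_self _))
  · refine Ideal.mem_sup_left ⟨Pi.single i 1, ?_⟩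
    rw [gammaMap, Fintype.linearCombination_apply_single, one_smul, gammaVec]

/-- `γ ∘ α` is `τ^*` up to multiplication by `± det (α ⊕ δ)`. -/
theorem det_mul_mem_range_gammaMap {b : R} (hb : b ∈ idealRho h) :
    (blockMatrix A C).det * b ∈ LinearMap.range (gammaMap h A C) := by
  have hle : idealRho h ≤
      (LinearMap.range (gammaMap h A C)).comap (LinearMap.mulLeft R (blockMatrix A C).det) := by
    rw [idealRho, Ideal.span_le]
    rintro _ ⟨j, rfl⟩
    have hrel := sum_signedMinor_mul (bMatrix h A C) (Fin.castAdd m j)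
    rw [Fin.sum_univ_castSucc, bMatrix_last, signedMinor_bMatrix_last, rhoVec,
      Fin.append_left] at hrel
    have hγ : gammaMap h A C (fun i => blockMatrix A C i (Fin.castAdd m j)) =
        ∑ i : Fin (3 + m), signedMinor (bMatrix h A C) i.castSucc *
          bMatrix h A C i.castSucc (Fin.castAdd m j) := by
      rw [gammaMap, Fintype.linearCombination_apply]
      refine Finset.sum_congr rfl fun i _ => ?_
      rw [bMatrix_castSucc, smul_eq_mul, mul_comm, gammaVec]
    -- The preimage is column j of A; the sign undoes that of the minor omitting the last row, moved
    -- across the relation.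
    refine ⟨(-(-1) ^ (3 + m + 1) : R) • fun i => blockMatrix A C i (Fin.castAdd m j), ?_⟩
    have hsq : ((-1 : R) ^ (3 + m + 1)) * (-1) ^ (3 + m + 1) = 1 := by
      rw [← mul_pow]
      simp
    rw [map_smul, hγ, LinearMap.mulLeft_apply, smul_eq_mul]
    linear_combination (-(-1) ^ (3 + m + 1)) * hrel + (blockMatrix A C).det * h j * hsq
  exact hle hb

end Minors

/-! ### The equality of ideals -/

section Ideals

variable {k : Type*} [Field k] {r m : ℕ}

/-- If the ideal `(h₁, h₂, h₃, det (A | C))` has height at least four, multiplication by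
`det (A | C)` is injective modulo `(h₁, h₂, h₃)`. -/
theorem mem_idealRho_of_mul_det_mem {I : Ideal (CoordRing k r)} {h : Fin 3 → CoordRing k r}
    {A : Matrix (Fin (3 + m)) (Fin 3) (CoordRing k r)}
    {C : Matrix (Fin (3 + m)) (Fin m) (CoordRing k r)} (hres : IsGradedMinimalResolution I h A C)
    (hcodim : 4 ≤ (idealDet A C ⊔ idealRho h).height) {c : CoordRing k r}
    (hc : c * (blockMatrix A C).det ∈ idealRho h) : c ∈ idealRho h := by
  obtain ⟨rs, hlen, hmem, hreg⟩ := exists_isWeaklyRegular_of_le_height 4 _ _ hcodim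
  match rs, hlen with
  | [g₁, g₂, g₃, g₄], _ =>
    have hrange : ∀ x, x ∈ idealRho h ↔ ∃ u, Fintype.linearCombination (CoordRing k r) h u = x := by
      intro x
      rw [idealRho, Ideal.span, ← Fintype.range_linearCombination]
      rfl
    have r₁ := fun x => mem_ofList_take_of_mul_mem hreg 0 (by simp) (x := x)
    have r₂ := fun x => mem_ofList_take_of_mul_mem hreg 1 (by simp) (x := x)
    have r₃ := fun x => mem_ofList_take_of_mul_mem hreg 2 (by simp) (x := x)
    have r₄ := fun x => mem_ofList_take_of_mul_mem hreg 3 (by simp) (x := x)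
    simp only [List.getElem_cons_zero, List.getElem_cons_succ, List.take_zero,
      List.take_succ_cons, mem_ofList_cons, Ideal.ofList_nil, Ideal.mem_bot] at r₁ r₂ r₃ r₄
    refine (hrange c).2 (mem_range_of_forall_mul_mem_range
      (exact_koszulMatrix_right hres.injective_rho hres.exact_rho_phi hres.exact_phi_gamma)
      (exact_koszulMatrix_left hres.injective_rho hres.exact_rho_phi)
      ?_ (hmem g₁ (by simp)) (hmem g₂ (by simp)) (hmem g₃ (by simp)) (hmem g₄ (by simp))
      r₁ ?_ ?_ ?_ ?_)
    · intro a b e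
      obtain ⟨i, hi⟩ := exists_ne_zero_of_injective_rhoMap hres.injective_rho
      exact mul_right_cancel₀ hi (congrFun e i)
    · intro x y e
      obtain ⟨p, _, rfl, e⟩ := r₂ _ ⟨y, 0, rfl, by rw [e, add_zero]⟩
      exact ⟨p, by rw [e, add_zero]⟩
    · intro x y z e
      obtain ⟨p, _, ⟨q, _, rfl, rfl⟩, e⟩ := r₃ _ ⟨y, _, ⟨z, 0, rfl, rfl⟩, by rw [e, add_zero]⟩
      exact ⟨p, q, by rw [e, add_zero]⟩
    · intro x y z w e
      obtain ⟨p, _, ⟨q, _, ⟨s, _, rfl, rfl⟩, rfl⟩, e⟩ :=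
        r₄ _ ⟨y, _, ⟨z, _, ⟨w, 0, rfl, rfl⟩, rfl⟩, by rw [e, add_zero, add_assoc]⟩
      exact ⟨p, q, s, by rw [e, add_zero, add_assoc]⟩
    -- Modulo (h), c is killed by h trivially and by D by assumption, hence by the whole ideal (h,
    -- D).
    · intro b hb
      rw [← hrange]
      obtain ⟨x, hx, y, hy, rfl⟩ := Submodule.mem_sup.1 hb
      obtain ⟨z, rfl⟩ := Ideal.mem_span_singleton'.1 hx
      rw [add_mul]
      refine Ideal.add_mem _ ?_ (Ideal.mul_mem_right _ _ hy)
      have := Ideal.mul_mem_left _ z hc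
      convert this using 1
      ring

theorem eq_idealB_inf_idealRho {I : Ideal (CoordRing k r)} {h : Fin 3 → CoordRing k r}
    {A : Matrix (Fin (3 + m)) (Fin 3) (CoordRing k r)}
    {C : Matrix (Fin (3 + m)) (Fin m) (CoordRing k r)} (hres : IsGradedMinimalResolution I h A C)
    (hcodim : 4 ≤ (idealDet A C ⊔ idealRho h).height) : I = idealB h A C ⊓ idealRho h := by
  have hI := hres.range_gamma
  refine le_antisymm (le_inf ?_ ?_) ?_
  · rw [← hI]
    exact range_gammaMap_le_idealB h A C
  · rw [← hI]
    exact range_gammaMap_le_idealRho h A C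
  · rintro f ⟨hfB, hfρ⟩
    obtain ⟨a, ha, b, hb, rfl⟩ := Submodule.mem_sup.1 (idealB_le h A C hfB)
    obtain ⟨c, rfl⟩ := Ideal.mem_span_singleton'.1 hb
    have hcρ : c ∈ idealRho h := mem_idealRho_of_mul_det_mem hres hcodim
      ((Ideal.add_mem_iff_right _ (range_gammaMap_le_idealRho h A C ha)).1 hfρ)
    rw [← hI]
    refine Submodule.add_mem _ ha ?_
    rw [mul_comm]
    exact det_mul_mem_range_gammaMap h A C hcρ

end Ideals

/-! ### Passage to ideal sheaves -/

section Schemes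

universe u

variable {k : Type u} [Field k] {r : ℕ}

theorem stalkIdeal_inf (I J : Ideal (CoordRing k r)) (x : ProjectiveSpectrum (stdGrading k r)) :
    stalkIdeal (I ⊓ J) x = stalkIdeal I x ⊓ stalkIdeal J x := by
  rw [stalkIdeal, IsLocalization.map_inf x.asHomogeneousIdeal.toIdeal.primeCompl, Ideal.comap_inf]
  rfl

theorem sectionIdeal_inf (I J : Ideal (CoordRing k r)) (U : (ProjSpace k r).Opens) :
    sectionIdeal (I ⊓ J) U = sectionIdeal I U ⊓ sectionIdeal J U := by
  simp only [sectionIdeal, stalkIdeal_inf, Ideal.comap_inf, iInf_inf_eq]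

/-- Intersections of ideals define scheme-theoretic unions. -/
theorem closedSubscheme_inf (I J : Ideal (CoordRing k r)) :
    closedSubscheme (I ⊓ J) = schemeUnion (closedSubscheme I) (closedSubscheme J) := by
  rw [schemeUnion, closedSubscheme, closedSubscheme, closedSubscheme,
    -- `ofIdeals` is an upper adjoint, so it preserves meets of families of ideals.
    ← Scheme.IdealSheafData.gci.gc.u_inf]
  congr 1
  funext U
  exact sectionIdeal_inf I J U.1

end Schemes

end GenGor

theorem mainTheorem7 {k : Type*} [Field k] {r m : ℕ} (hr : 3 ≤ r)
    (IX : Ideal (GenGor.CoordRing k r))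
    (h : Fin 3 → GenGor.CoordRing k r)
    (A : Matrix (Fin (3 + m)) (Fin 3) (GenGor.CoordRing k r))
    (C : Matrix (Fin (3 + m)) (Fin m) (GenGor.CoordRing k r))
    (hres : GenGor.IsGradedMinimalResolution IX h A C)
    (X Y Z : GenGor.ClosedSubscheme k r)
    (hX : X = GenGor.closedSubscheme IX)
    (hZ : Z = GenGor.closedSubscheme (GenGor.idealRho h))
    (hY : Y = GenGor.closedSubscheme (GenGor.idealB h A C))
    (hcodim : 4 ≤ (GenGor.idealDet A C ⊔ GenGor.idealRho h).height) :
    X = GenGor.schemeUnion Y Z ∧ IX = GenGor.idealB h A C ⊓ GenGor.idealRho h := by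
  have key := GenGor.eq_idealB_inf_idealRho hres hcodim
  refine ⟨?_, key⟩
  rw [hX, hY, hZ, ← GenGor.closedSubscheme_inf, ← key]
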